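/- Let $G$ be an arbitrary discrete group and let $X$ be a $G$-space, i.e. a compact Hausdorff space on which $G$ acts by homeomorphisms; let $G$ act on $C(X)$ (complex-valued continuous functions) by $(g\cdot f)(x)=f(g^{-1}x)$. Conventions. An operator system is a complex vector space with a conjugate-linear involution, a compatible family of proper cones of positive hermitian $n\times n$ matrices ($n\ge 0$), and an Archimedean matrix order unit. A unital C*-algebra $A$ is an operator system whose positive $n\times n$ matrices are those of the form $N^*N$ with $N\in M_n(A)$. A unital complete order embedding is a unital completely positive map that also reflects positivity of matrices of every size. A $G$-operator system is an operator system on which $G$ acts linearly by unital complete order automorphisms; the morphisms between $G$-operator systems are the $G$-equivariant unital completely positive maps. A $G$-operator system $E$ is $G$-injective if every morphism $S\to E$ extends along every $G$-equivariant unital complete order embedding $S\to T$ of $G$-operator systems to a morphism $T\to E$. A $G$-injective envelope of a $G$-operator system $V$ is a $G$-injective $G$-operator system $E$ with a $G$-equivariant unital complete order embedding $j:V\to E$ that is $G$-rigid (the only morphism $\varphi:E\to E$ with $\varphi\circ j=j$ is the identity) and $G$-essential (a morphism $\varphi:E\to Z$ is a complete order embedding whenever $\varphi\circ j$ is). Theorem.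 Let $(E,j)$ be a $G$-injective envelope $I_G(C(X))$ of $C(X)$. Then $E$ is an abelian C*-algebra: there are a commutative unital C*-algebra $A$ and a linear bijection $e:E\to A$ that is a unital complete order isomorphism. The product that $E$ receives from $A$ is the Choi–Effros product: whenever $B$ is a unital C*-algebra, $i:E\to B$ is a unital complete order embedding and $\varphi:B\to E$ is a unital completely positive map with $\varphi\circ i=\mathrm{id}_E$, one has $e(\varphi(i(x)i(y)))=e(x)e(y)$ for all $x,y\in E$. For this product $G$ acts on $E$ by algebra automorphisms and $j:C(X)\to E$ is multiplicative. -/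

import Mathlib

open scoped Matrix

universe u v w

noncomputable section

/-- The matrix `B* M B` over a complex vector space `V`, where `B` is a rectangular scalar matrix and
`M` is a square matrix with entries in `V`. -/
def compress {V : Type*} [AddCommGroup V] [Module ℂ V] {m n : ℕ} (B : Matrix (Fin m) (Fin n) ℂ)
    (M : Matrix (Fin m) (Fin m) V) : Matrix (Fin n) (Fin n) V :=
  Matrix.of fun i j => ∑ k, ∑ l, (star (B k i) * B l j) • M k l

/-- An (abstract) operator system in the sense of Choi and Effros: a complex vector space with a
conjugate-linear involution, a compatible family of proper cones in the spaces of hermitian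
matrices over `V`, and an Archimedean matrix order unit. -/
class OperatorSystem (V : Type*) [AddCommGroup V] [Module ℂ V] [StarAddMonoid V]
    [StarModule ℂ V] where
  /-- the order unit -/
  unit : V
  /-- the positive `n × n` matrices -/
  cone (n : ℕ) : Set (Matrix (Fin n) (Fin n) V)
  conjTranspose_eq {n : ℕ} {M : Matrix (Fin n) (Fin n) V} : M ∈ cone n → Mᴴ = M
  add_mem {n : ℕ} {M N : Matrix (Fin n) (Fin n) V} : M ∈ cone n → N ∈ cone n → M + N ∈ cone n
  smul_mem {n : ℕ} {M : Matrix (Fin n) (Fin n) V} (r : ℝ) :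
    0 ≤ r → M ∈ cone n → (r : ℂ) • M ∈ cone n
  eq_zero {n : ℕ} {M : Matrix (Fin n) (Fin n) V} : M ∈ cone n → -M ∈ cone n → M = 0
  compress_mem {m n : ℕ} (B : Matrix (Fin m) (Fin n) ℂ) {M : Matrix (Fin m) (Fin m) V} :
    M ∈ cone m → compress B M ∈ cone n
  exists_add_mem {n : ℕ} {M : Matrix (Fin n) (Fin n) V} : Mᴴ = M →
    ∃ r : ℝ, 0 < r ∧ (r : ℂ) • Matrix.diagonal (fun _ => unit) + M ∈ cone n
  archimedean {n : ℕ} {M : Matrix (Fin n) (Fin n) V} : Mᴴ = M →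
    (∀ r : ℝ, 0 < r → (r : ℂ) • Matrix.diagonal (fun _ => unit) + M ∈ cone n) → M ∈ cone n

/-- Unital completely positive linear maps between operator systems. -/
structure IsUCP {V W : Type*} [AddCommGroup V] [Module ℂ V] [StarAddMonoid V] [StarModule ℂ V]
    [OperatorSystem V] [AddCommGroup W] [Module ℂ W] [StarAddMonoid W] [StarModule ℂ W]
    [OperatorSystem W] (φ : V →ₗ[ℂ] W) : Prop where
  map_unit : φ OperatorSystem.unit = OperatorSystem.unit
  map_mem (n : ℕ) (M : Matrix (Fin n) (Fin n) V) :
    M ∈ OperatorSystem.cone n → M.map φ ∈ OperatorSystem.cone n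

/-- Unital complete order embeddings: unital completely positive maps which also reflect positivity
of matrices (such a map is injective, since the cones are proper). -/
structure IsCompleteOrderEmbedding {V W : Type*} [AddCommGroup V] [Module ℂ V] [StarAddMonoid V]
    [StarModule ℂ V] [OperatorSystem V] [AddCommGroup W] [Module ℂ W] [StarAddMonoid W]
    [StarModule ℂ W] [OperatorSystem W] (φ : V →ₗ[ℂ] W) : Prop extends IsUCP φ where
  reflects (n : ℕ) (M : Matrix (Fin n) (Fin n) V) :
    M.map φ ∈ OperatorSystem.cone n → M ∈ OperatorSystem.cone n

/-- A `G`-operator system: `G` acts linearly by unital complete order automorphisms. (As `G` is a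
group, it is enough that every group element preserves the unit and the cones.) -/
class IsGOperatorSystem (G V : Type*) [Group G] [AddCommGroup V] [Module ℂ V] [StarAddMonoid V]
    [StarModule ℂ V] [OperatorSystem V] [DistribMulAction G V] [SMulCommClass G ℂ V] : Prop where
  smul_unit (g : G) : g • (OperatorSystem.unit : V) = OperatorSystem.unit
  smul_mem (g : G) (n : ℕ) (M : Matrix (Fin n) (Fin n) V) :
    M ∈ OperatorSystem.cone n → M.map (g • ·) ∈ OperatorSystem.cone n

/-- `G`-equivariance of a linear map. -/
def IsGEquivariant (G : Type*) {V W : Type*} [Group G] [AddCommGroup V] [Module ℂ V]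
    [AddCommGroup W] [Module ℂ W] [DistribMulAction G V] [DistribMulAction G W]
    (φ : V →ₗ[ℂ] W) : Prop :=
  ∀ (g : G) (x : V), φ (g • x) = g • φ x

/-- `E` is injective in the category of `G`-operator systems and `G`-equivariant unital completely
positive maps: such maps into `E` extend along `G`-equivariant unital complete order embeddings. -/
def IsGInjective (G : Type u) [Group G] (E : Type w) [AddCommGroup E] [Module ℂ E]
    [StarAddMonoid E] [StarModule ℂ E] [OperatorSystem E] [DistribMulAction G E] : Prop :=
  ∀ (S T : Type w)
    [AddCommGroup S] [Module ℂ S] [StarAddMonoid S] [StarModule ℂ S] [OperatorSystem S]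
    [DistribMulAction G S] [SMulCommClass G ℂ S] [IsGOperatorSystem G S]
    [AddCommGroup T] [Module ℂ T] [StarAddMonoid T] [StarModule ℂ T] [OperatorSystem T]
    [DistribMulAction G T] [SMulCommClass G ℂ T] [IsGOperatorSystem G T]
    (i : S →ₗ[ℂ] T) (φ : S →ₗ[ℂ] E),
    IsCompleteOrderEmbedding i → IsGEquivariant G i → IsUCP φ → IsGEquivariant G φ →
      ∃ ψ : T →ₗ[ℂ] E, IsUCP ψ ∧ IsGEquivariant G ψ ∧ ψ ∘ₗ i = φ

/-- `(E, j)` is a `G`-injective envelope of the `G`-operator system `V`: `E` is a `G`-injective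
`G`-operator system, and `j : V → E` is a `G`-equivariant unital complete order embedding which is
`G`-rigid and `G`-essential. -/
structure IsGInjectiveEnvelope (G : Type u) [Group G] {V : Type v} [AddCommGroup V] [Module ℂ V]
    [StarAddMonoid V] [StarModule ℂ V] [OperatorSystem V] [DistribMulAction G V]
    {E : Type w} [AddCommGroup E] [Module ℂ E] [StarAddMonoid E] [StarModule ℂ E]
    [OperatorSystem E] [DistribMulAction G E] (j : V →ₗ[ℂ] E) : Prop where
  embedding : IsCompleteOrderEmbedding j
  equivariant : IsGEquivariant G j
  injective : IsGInjective G E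
  rigid (φ : E →ₗ[ℂ] E) : IsUCP φ → IsGEquivariant G φ → φ ∘ₗ j = j → φ = LinearMap.id
  essential (Z : Type w) [AddCommGroup Z] [Module ℂ Z] [StarAddMonoid Z] [StarModule ℂ Z]
    [OperatorSystem Z] [DistribMulAction G Z] [SMulCommClass G ℂ Z] [IsGOperatorSystem G Z]
    (φ : E →ₗ[ℂ] Z) : IsUCP φ → IsGEquivariant G φ →
      IsCompleteOrderEmbedding (φ ∘ₗ j) → IsCompleteOrderEmbedding φ

section CStar

variable {A : Type*} [CStarAlgebra A]

/-- The positive elements `N* N` of the C*-algebra of `n × n` matrices over `A`. -/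
def matrixCone (A : Type*) [CStarAlgebra A] (n : ℕ) : Set (Matrix (Fin n) (Fin n) A) :=
  {M | ∃ N : Matrix (Fin n) (Fin n) A, M = Nᴴ * N}

theorem nonneg_iff_star_mul_self {B : Type*} [NonUnitalCStarAlgebra B] [PartialOrder B]
    [StarOrderedRing B] (a : B) : 0 ≤ a ↔ ∃ b, a = star b * b :=
  CStarAlgebra.nonneg_iff_eq_star_mul_self

theorem norm_add_one_smul_add_nonneg {B : Type*} [CStarAlgebra B] [PartialOrder B]
    [StarOrderedRing B] (a : B) (h : IsSelfAdjoint a) :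
    0 ≤ ((‖a‖ + 1 : ℝ) : ℂ) • (1 : B) + a := by
  have h1 := h.neg_algebraMap_norm_le_self
  have h2 : algebraMap ℝ B ‖a‖ ≤ algebraMap ℝ B (‖a‖ + 1) := algebraMap_mono _ (by linarith)
  have h3 := (neg_le_neg h2).trans h1
  rw [neg_le_iff_add_nonneg', Algebra.algebraMap_eq_smul_one] at h3
  rwa [Complex.coe_smul]

theorem mem_matrixCone_iff [PartialOrder A] [StarOrderedRing A] {n : ℕ}
    {M : Matrix (Fin n) (Fin n) A} :
    M ∈ matrixCone A n ↔ 0 ≤ CStarMatrix.ofMatrix M :=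
  (nonneg_iff_star_mul_self (CStarMatrix.ofMatrix M)).symm

theorem matrixCone_add {n : ℕ} {M N : Matrix (Fin n) (Fin n) A} (hM : M ∈ matrixCone A n)
    (hN : N ∈ matrixCone A n) : M + N ∈ matrixCone A n := by
  let _ := CStarAlgebra.spectralOrder A
  have := CStarAlgebra.spectralOrderedRing A
  rw [mem_matrixCone_iff] at *
  exact add_nonneg hM hN

theorem matrixCone_zero (n : ℕ) : (0 : Matrix (Fin n) (Fin n) A) ∈ matrixCone A n :=
  ⟨0, by simp⟩

theorem matrixCone_sum {n : ℕ} {ι : Type*} (s : Finset ι) (f : ι → Matrix (Fin n) (Fin n) A)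
    (h : ∀ i ∈ s, f i ∈ matrixCone A n) : ∑ i ∈ s, f i ∈ matrixCone A n :=
  Finset.sum_induction f (· ∈ matrixCone A n) (fun _ _ => matrixCone_add) (matrixCone_zero n) h

theorem matrixCone_row {n : ℕ} (v : Fin n → A) :
    Matrix.of (fun i j => star (v i) * v j) ∈ matrixCone A n := by
  cases n with
  | zero => exact ⟨0, Subsingleton.elim _ _⟩
  | succ n =>
    refine ⟨Matrix.of fun k i => if k = 0 then v i else 0, ?_⟩
    ext i j
    simp [Matrix.mul_apply]

theorem matrixCone_compress {m n : ℕ} (B : Matrix (Fin m) (Fin n) ℂ)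
    {M : Matrix (Fin m) (Fin m) A} (hM : M ∈ matrixCone A m) :
    compress B M ∈ matrixCone A n := by
  obtain ⟨N, rfl⟩ := hM
  have : compress B (Nᴴ * N) = ∑ p, Matrix.of
      (fun i j => star (∑ k, B k i • N p k) * (∑ l, B l j • N p l)) := by
    ext i j
    simp only [compress, Matrix.of_apply, Matrix.mul_apply, Matrix.conjTranspose_apply,
      Matrix.sum_apply, Finset.smul_sum, star_sum, star_smul, Finset.sum_mul_sum,
      smul_mul_smul_comm]
    conv_rhs => rw [Finset.sum_comm]
    refine Finset.sum_congr rfl fun k _ => ?_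
    rw [Finset.sum_comm]
  rw [this]
  exact matrixCone_sum _ _ fun p _ => matrixCone_row _

theorem matrixCone_eq_zero {n : ℕ} {M : Matrix (Fin n) (Fin n) A} (h : M ∈ matrixCone A n)
    (h' : -M ∈ matrixCone A n) : M = 0 := by
  let _ := CStarAlgebra.spectralOrder A
  have := CStarAlgebra.spectralOrderedRing A
  rw [mem_matrixCone_iff] at h h'
  have h2 : 0 ≤ -CStarMatrix.ofMatrix M := h'
  exact le_antisymm (a := CStarMatrix.ofMatrix M) (neg_nonneg.mp h2) h

theorem matrixCone_exists {n : ℕ} {M : Matrix (Fin n) (Fin n) A} (h : Mᴴ = M) :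
    ∃ r : ℝ, 0 < r ∧ (r : ℂ) • Matrix.diagonal (fun _ => (1 : A)) + M ∈ matrixCone A n := by
  let _ := CStarAlgebra.spectralOrder A
  have := CStarAlgebra.spectralOrderedRing A
  have hs : IsSelfAdjoint (CStarMatrix.ofMatrix M) := h
  refine ⟨‖CStarMatrix.ofMatrix M‖ + 1, by positivity, ?_⟩
  rw [mem_matrixCone_iff]
  exact norm_add_one_smul_add_nonneg _ hs

theorem matrixCone_archimedean {n : ℕ} {M : Matrix (Fin n) (Fin n) A}
    (h : ∀ r : ℝ, 0 < r → (r : ℂ) • Matrix.diagonal (fun _ => (1 : A)) + M ∈ matrixCone A n) :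
    M ∈ matrixCone A n := by
  let _ := CStarAlgebra.spectralOrder A
  have := CStarAlgebra.spectralOrderedRing A
  simp only [mem_matrixCone_iff] at *
  have hc : Continuous fun r : ℝ =>
      (r : ℂ) • (1 : CStarMatrix (Fin n) (Fin n) A) + CStarMatrix.ofMatrix M := by fun_prop
  have ht := (hc.tendsto 0).mono_left (nhdsWithin_le_nhds (s := Set.Ioi 0))
  have := CStarAlgebra.isClosed_nonneg.mem_of_tendsto ht
    (Filter.eventually_of_mem self_mem_nhdsWithin fun r hr => h r hr)
  simpa using this

/-- A unital C*-algebra is an operator system with its unit, its involution and the positive cones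
of its matrix algebras. -/
instance CStarAlgebra.instOperatorSystem (A : Type*) [CStarAlgebra A] : OperatorSystem A where
  unit := 1
  cone := matrixCone A
  conjTranspose_eq := by
    rintro n M ⟨N, rfl⟩
    simp [Matrix.conjTranspose_mul]
  add_mem := matrixCone_add
  smul_mem := by
    rintro n M r hr ⟨N, rfl⟩
    refine ⟨(Real.sqrt r : ℂ) • N, ?_⟩
    rw [Matrix.conjTranspose_smul, Matrix.smul_mul, Matrix.mul_smul, smul_smul]
    simp [← Complex.ofReal_mul, Real.mul_self_sqrt hr]
  eq_zero := matrixCone_eq_zero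
  compress_mem := matrixCone_compress
  exists_add_mem := matrixCone_exists
  archimedean := fun _ => matrixCone_archimedean

end CStar

section GSpace

variable {G : Type*} [Group G] {X : Type*} [TopologicalSpace X] [CompactSpace X] [MulAction G X]
  [ContinuousConstSMul G X]

/-- The action of `G` on `C(X)` induced by an action on `X`: `(g • f)(x) = f(g⁻¹ • x)`. -/
instance ContinuousMap.instGAction : DistribMulAction G C(X, ℂ) where
  smul g f := f.comp ⟨fun x => g⁻¹ • x, continuous_const_smul g⁻¹⟩
  one_smul f := by ext x; exact congrArg f (by simp)
  mul_smul g h f := by ext x; exact congrArg f (by simp [mul_smul])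
  smul_zero _ := rfl
  smul_add _ _ _ := rfl

theorem ContinuousMap.gAction_apply (g : G) (f : C(X, ℂ)) (x : X) : (g • f) x = f (g⁻¹ • x) := rfl

instance ContinuousMap.instGActionSMulComm : SMulCommClass G ℂ C(X, ℂ) where
  smul_comm _ _ _ := rfl

instance ContinuousMap.instIsGOperatorSystem : IsGOperatorSystem G C(X, ℂ) where
  smul_unit _ := rfl
  smul_mem := by
    rintro g n M ⟨N, rfl⟩
    refine ⟨N.map (g • ·), ?_⟩
    ext i j x
    simp [Matrix.mul_apply, ContinuousMap.gAction_apply]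

end GSpace

end

/-! The envelope is an equivariant retract of the commutative C*-algebra `ℓ^∞(G × X)`, and a retract
of a commutative C*-algebra is itself one for the Choi–Effros product.

The retraction: `f ↦ ((g, x) ↦ f (g • x))` embeds `C(X)` equivariantly in `ℓ^∞(G × X)`. Extending
the point evaluations of `X` to states of `E` and translating them along `G` extends this embedding
to an equivariant `θ` on `E`. Conversely, `G`-injectivity of `E` extends `j` to an equivariant `ψ :
ℓ^∞(G × X) → E`. As `ψ ∘ θ` fixes `j`, rigidity forces `ψ ∘ θ = id`
(`IsGInjectiveEnvelope.exists_retraction`).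

The product: `P = θ ∘ ψ` is a unital completely positive idempotent with `P (P x * c) = P (x * c)`
for `c` in its range (`IsUCP.map_map_mul`). Hence `P (a * b)` is an associative product on the
range, and the Schwarz inequality gives the C*-identity. The characters of the new algebra are
positive for the old order, so the matrix orders agree (`isCompleteOrderEmbedding_retractEquiv`).

Uniqueness: two Schwarz inequalities show that a retraction between C*-algebras determines the
product (`IsUCP.map_mul_of_leftInverse`). This yields both the comparison with any other Choi–Effros
product and the multiplicativity of the action. Finally `j` is multiplicative because `θ ∘ j` is. -/

noncomputable section

open scoped ComplexOrder ENNReal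

/-! ### Positive elements and positive functionals of operator systems -/

section Positive

variable {V W : Type*} [AddCommGroup V] [Module ℂ V] [StarAddMonoid V] [StarModule ℂ V]
  [OperatorSystem V] [AddCommGroup W] [Module ℂ W] [StarAddMonoid W] [StarModule ℂ W]
  [OperatorSystem W]

/-- Positive elements of an operator system. -/
def IsPositiveElement (x : V) : Prop :=
  (Matrix.of fun _ _ => x : Matrix (Fin 1) (Fin 1) V) ∈ OperatorSystem.cone 1

theorem IsPositiveElement.star_eq {x : V} (h : IsPositiveElement x) : star x = x := by
  have := congrFun (congrFun (OperatorSystem.conjTranspose_eq h) 0) 0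
  simpa using this

theorem IsPositiveElement.smul {x : V} (h : IsPositiveElement x) {r : ℝ} (hr : 0 ≤ r) :
    IsPositiveElement ((r : ℂ) • x) := by
  have := OperatorSystem.smul_mem r hr h
  exact this

theorem IsPositiveElement.add {x y : V} (hx : IsPositiveElement x) (hy : IsPositiveElement y) :
    IsPositiveElement (x + y) :=
  OperatorSystem.add_mem hx hy

theorem isPositiveElement_congr {M : Matrix (Fin 1) (Fin 1) V} :
    M ∈ OperatorSystem.cone 1 ↔ IsPositiveElement (M 0 0) := by
  have : M = Matrix.of fun _ _ => M 0 0 := by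
    ext i j
    rw [Subsingleton.elim i 0, Subsingleton.elim j 0]
    rfl
  rw [IsPositiveElement, ← this]

theorem exists_smul_unit_add_isPositiveElement {x : V} (h : star x = x) :
    ∃ r : ℝ, 0 < r ∧ IsPositiveElement ((r : ℂ) • OperatorSystem.unit + x) := by
  obtain ⟨r, hr, hx⟩ := OperatorSystem.exists_add_mem (n := 1) (V := V)
    (M := Matrix.of fun _ _ => x) (by ext i j; simpa using h)
  refine ⟨r, hr, ?_⟩
  rw [isPositiveElement_congr] at hx
  simpa using hx

/-- Positivity of the unit is not an axiom: the order unit property at `0` makes some positive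
multiple of it positive, and rescaling gives all the others. -/
theorem isPositiveElement_smul_unit {r : ℝ} (hr : 0 ≤ r) :
    IsPositiveElement ((r : ℂ) • (OperatorSystem.unit : V)) := by
  obtain ⟨s, hs, h⟩ := exists_smul_unit_add_isPositiveElement (x := (0 : V)) (by simp)
  have := h.smul (div_nonneg hr hs.le)
  rw [add_zero, smul_smul, ← Complex.ofReal_mul, div_mul_cancel₀ _ hs.ne'] at this
  exact this

theorem star_unit : star (OperatorSystem.unit : V) = OperatorSystem.unit := by
  have := (isPositiveElement_smul_unit (V := V) (r := 1) zero_le_one).star_eq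
  simpa using this

theorem isPositiveElement_compress {n : ℕ} {M : Matrix (Fin n) (Fin n) V}
    (hM : M ∈ OperatorSystem.cone n) (v : Fin n → ℂ) :
    IsPositiveElement (∑ k, ∑ l, (star (v k) * v l) • M k l) :=
  OperatorSystem.compress_mem (Matrix.of fun k (_ : Fin 1) => v k) hM

theorem IsUCP.isPositiveElement {φ : V →ₗ[ℂ] W} (hφ : IsUCP φ) {x : V}
    (hx : IsPositiveElement x) : IsPositiveElement (φ x) :=
  hφ.map_mem 1 _ hx

theorem IsUCP.comp {U : Type*} [AddCommGroup U] [Module ℂ U] [StarAddMonoid U] [StarModule ℂ U]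
    [OperatorSystem U] {φ : V →ₗ[ℂ] W} {ψ : U →ₗ[ℂ] V} (hφ : IsUCP φ) (hψ : IsUCP ψ) :
    IsUCP (φ ∘ₗ ψ) where
  map_unit := by simp [hψ.map_unit, hφ.map_unit]
  map_mem n M hM := hφ.map_mem n _ (hψ.map_mem n M hM)

/-- A linear map which sends positive elements to hermitian ones preserves the involution. -/
theorem map_star_of_isPositiveElement {F : Type*} [AddCommGroup F] [Module ℂ F] [StarAddMonoid F]
    [StarModule ℂ F] (φ : V →ₗ[ℂ] F) (h : ∀ x, IsPositiveElement x → star (φ x) = φ x) (x : V) :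
    φ (star x) = star (φ x) := by
  -- A hermitian `y` is the difference of the positive elements `r • 1 + y` and `r • 1`.
  have key : ∀ y : V, star y = y → star (φ y) = φ y := by
    intro y hy
    obtain ⟨r, hr, hp⟩ := exists_smul_unit_add_isPositiveElement hy
    have h1 := h _ hp
    have h2 := h _ (isPositiveElement_smul_unit (V := V) hr.le)
    rw [map_add, star_add, h2] at h1
    exact add_left_cancel h1
  -- A general `x` is recovered from the hermitian elements `x + x*` and `i (x - x*)`.
  have h1 := key (x + star x) (by simp [add_comm])
  have h2 := key (Complex.I • (x - star x)) (by simp [star_smul, ← smul_neg])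
  simp only [map_add, map_smul, map_sub, star_add, star_smul, star_sub, Complex.star_def,
    Complex.conj_I, neg_smul, ← smul_neg, neg_sub] at h1 h2
  have h3 := smul_right_injective F Complex.I_ne_zero h2
  have h4 : (2 : ℂ) • φ (star x) = (2 : ℂ) • star (φ x) := by
    linear_combination (norm := module) h3 - h1
  exact smul_right_injective F two_ne_zero h4

theorem IsUCP.map_star {φ : V →ₗ[ℂ] W} (hφ : IsUCP φ) (x : V) : φ (star x) = star (φ x) :=
  map_star_of_isPositiveElement φ (fun _ hx => (hφ.isPositiveElement hx).star_eq) x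

theorem Complex.star_eq_of_nonneg {z : ℂ} (h : 0 ≤ z) : star z = z :=
  IsSelfAdjoint.of_nonneg h

/-- Positive functionals are completely positive. -/
theorem posSemidef_map_of_isPositiveElement {f : V →ₗ[ℂ] ℂ}
    (hf : ∀ x, IsPositiveElement x → 0 ≤ f x) {n : ℕ} {M : Matrix (Fin n) (Fin n) V}
    (hM : M ∈ OperatorSystem.cone n) : (M.map f).PosSemidef := by
  refine Matrix.PosSemidef.of_dotProduct_mulVec_nonneg ?_ fun v => ?_
  · have h := OperatorSystem.conjTranspose_eq hM
    rw [Matrix.IsHermitian]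
    nth_rw 2 [← h]
    ext i j
    simp only [Matrix.conjTranspose_apply, Matrix.map_apply]
    exact (map_star_of_isPositiveElement f
      (fun x hx => Complex.star_eq_of_nonneg (hf x hx)) _).symm
  · have := hf _ (isPositiveElement_compress hM v)
    convert this using 1
    simp only [dotProduct, Matrix.mulVec, map_sum, map_smul, Finset.mul_sum, Matrix.map_apply,
      smul_eq_mul, Pi.star_apply]
    exact Finset.sum_congr rfl fun i _ => Finset.sum_congr rfl fun k _ => by ring

end Positive

/-! ### Schwarz inequality, contractivity and rigidity of the product -/

section CStar

variable {A B : Type*} [CStarAlgebra A] [CStarAlgebra B]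

theorem isPositiveElement_iff_exists {a : A} :
    IsPositiveElement a ↔ ∃ b, a = star b * b := by
  constructor
  · rintro ⟨N, hN⟩
    refine ⟨N 0 0, ?_⟩
    simpa [Matrix.mul_apply] using congrFun (congrFun hN 0) 0
  · rintro ⟨b, rfl⟩
    refine ⟨Matrix.of fun _ _ => b, ?_⟩
    ext i j
    simp [Matrix.mul_apply]

theorem isPositiveElement_iff_nonneg [PartialOrder A] [StarOrderedRing A] {a : A} :
    IsPositiveElement a ↔ 0 ≤ a := by
  rw [isPositiveElement_iff_exists, nonneg_iff_star_mul_self]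

/-- The Schwarz inequality for unital completely positive maps. -/
theorem IsUCP.schwarz [PartialOrder B] [StarOrderedRing B] {φ : A →ₗ[ℂ] B} (hφ : IsUCP φ) (a : A) :
    star (φ a) * φ a ≤ φ (star a * a) := by
  -- The positive matrix with rows `(1, a)` and `(a*, a* a)` is sent to some `N* N`.
  obtain ⟨N, hN⟩ := hφ.map_mem 2 _ (matrixCone_row ![1, a])
  have h1 : φ 1 = 1 := hφ.map_unit
  have e00 := congrFun (congrFun hN 0) 0
  have e01 := congrFun (congrFun hN 0) 1
  have e10 := congrFun (congrFun hN 1) 0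
  have e11 := congrFun (congrFun hN 1) 1
  simp only [Matrix.map_apply, Matrix.of_apply, Matrix.cons_val_zero, Matrix.cons_val_one,
    star_one, one_mul, mul_one, h1, hφ.map_star, Matrix.mul_apply, Matrix.conjTranspose_apply,
    Fin.sum_univ_two] at e00 e01 e10 e11
  -- Schur complement: compress `N* N` by the column `(-φ a, 1)`.
  have key : φ (star a * a) - star (φ a) * φ a =
      ∑ k, star (N k 1 - N k 0 * φ a) * (N k 1 - N k 0 * φ a) := by
    have : ∑ k, star (N k 1 - N k 0 * φ a) * (N k 1 - N k 0 * φ a) =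
        (star (N 0 1) * N 0 1 + star (N 1 1) * N 1 1)
        - (star (N 0 1) * N 0 0 + star (N 1 1) * N 1 0) * φ a
        - star (φ a) * (star (N 0 0) * N 0 1 + star (N 1 0) * N 1 1)
        + star (φ a) * (star (N 0 0) * N 0 0 + star (N 1 0) * N 1 0) * φ a := by
      simp only [Fin.sum_univ_two, star_sub, star_mul]
      noncomm_ring
    rw [this, ← e00, ← e01, ← e10, ← e11]
    noncomm_ring
  rw [← sub_nonneg, key]
  exact Finset.sum_nonneg fun k _ => star_mul_self_nonneg _

theorem IsUCP.monotone [PartialOrder A] [StarOrderedRing A] [PartialOrder B] [StarOrderedRing B]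
    {φ : A →ₗ[ℂ] B} (hφ : IsUCP φ) : Monotone φ := by
  intro a b h
  rw [← sub_nonneg, ← map_sub, ← isPositiveElement_iff_nonneg]
  exact hφ.isPositiveElement (isPositiveElement_iff_nonneg.mpr (sub_nonneg.mpr h))

/-- Unital completely positive maps between C*-algebras are contractive. -/
theorem IsUCP.norm_le {φ : A →ₗ[ℂ] B} (hφ : IsUCP φ) (a : A) : ‖φ a‖ ≤ ‖a‖ := by
  let _ := CStarAlgebra.spectralOrder A
  have := CStarAlgebra.spectralOrderedRing A
  let _ := CStarAlgebra.spectralOrder B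
  have := CStarAlgebra.spectralOrderedRing B
  have h1 : φ 1 = 1 := hφ.map_unit
  have h2 : star a * a ≤ algebraMap ℝ A (‖a‖ ^ 2) := by
    rw [← CStarAlgebra.norm_le_iff_le_algebraMap _ (by positivity) (star_mul_self_nonneg a),
      CStarRing.norm_star_mul_self, sq]
  have h3 := (hφ.schwarz a).trans (hφ.monotone h2)
  have h4 : φ (algebraMap ℝ A (‖a‖ ^ 2)) = algebraMap ℝ B (‖a‖ ^ 2) := by
    rw [Algebra.algebraMap_eq_smul_one, Algebra.algebraMap_eq_smul_one, ← Complex.coe_smul,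
      ← Complex.coe_smul, map_smul, h1]
  rw [h4, ← CStarAlgebra.norm_le_iff_le_algebraMap _ (by positivity) (star_mul_self_nonneg _),
      CStarRing.norm_star_mul_self, ← sq] at h3
  exact le_of_sq_le_sq h3 (norm_nonneg _)

/-- If `φ ∘ i = id` for unital completely positive maps between C*-algebras, then `φ` sends the
product of `i x` and `i y` to the product of `x` and `y`. -/
theorem IsUCP.map_mul_of_leftInverse {i : A →ₗ[ℂ] B} {φ : B →ₗ[ℂ] A} (hi : IsUCP i) (hφ : IsUCP φ)
    (h : φ ∘ₗ i = LinearMap.id) (x y : A) : φ (i x * i y) = x * y := by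
  let _ := CStarAlgebra.spectralOrder A
  have := CStarAlgebra.spectralOrderedRing A
  let _ := CStarAlgebra.spectralOrder B
  have := CStarAlgebra.spectralOrderedRing B
  have hid : ∀ a, φ (i a) = a := fun a => LinearMap.congr_fun h a
  -- The Schwarz inequality for `i`, followed by `φ`, gives one bound; the Schwarz inequality for
  -- `φ` at `i a` gives the other.
  have hsq : ∀ a : A, φ (star (i a) * i a) = star a * a := by
    intro a
    apply le_antisymm
    · have := hφ.monotone (hi.schwarz a)
      rwa [hid] at this
    · have := hφ.schwarz (i a)
      rwa [hid] at this
  -- polarization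
  have hpol : ∀ a b : A, φ (star (i a) * i b) = star a * b := by
    intro a b
    have h1 := hsq (a + b)
    have h2 := hsq (a + Complex.I • b)
    simp only [map_add, map_smul, star_add, star_smul, add_mul, mul_add, hsq, smul_mul_assoc,
      mul_smul_comm, Complex.star_def, Complex.conj_I] at h1 h2
    have h3 := congrArg (-Complex.I • ·) h2
    simp only [smul_add, smul_smul, mul_neg, neg_mul, Complex.I_mul_I, neg_neg, one_smul] at h3
    have e5 : (2 : ℂ) • φ (star (i a) * i b) = (2 : ℂ) • (star a * b) := by
      linear_combination (norm := module) h1 + h3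
    exact smul_right_injective A two_ne_zero e5
  have := hpol (star x) y
  rwa [hi.map_star, star_star, star_star] at this

end CStar

/-! ### Positivity of matrices over commutative C*-algebras, tested on characters -/

section Characters

theorem nonneg_of_isUnit_sub_smul_one {B : Type*} [CStarAlgebra B] [PartialOrder B]
    [StarOrderedRing B] (b : B) (hb : IsSelfAdjoint b)
    (h : ∀ r : ℝ, r < 0 → IsUnit (b - (r : ℂ) • 1)) : 0 ≤ b := by
  refine (StarOrderedRing.nonneg_iff_spectrum_nonneg (R := ℝ) b hb).mpr fun r hr => ?_
  by_contra! hlt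
  refine hr ?_
  rw [spectrum.mem_resolventSet_iff, Algebra.algebraMap_eq_smul_one, ← neg_sub, ← Complex.coe_smul]
  exact (h r hlt).neg

/-- A matrix over a commutative C*-algebra is positive as soon as its images under a family of
characters that separates points and detects units are positive semidefinite. -/
theorem mem_matrixCone_of_posSemidef {A : Type*} [CommCStarAlgebra A] {ι : Type*}
    (F : ι → A →⋆ₐ[ℂ] ℂ) (hinj : ∀ a, (∀ i, F i a = 0) → a = 0)
    (hunit : ∀ a, (∀ i, F i a ≠ 0) → IsUnit a) {n : ℕ} (M : Matrix (Fin n) (Fin n) A)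
    (hM : ∀ i, (M.map (F i)).PosSemidef) : M ∈ matrixCone A n := by
  let _ := CStarAlgebra.spectralOrder A
  have := CStarAlgebra.spectralOrderedRing A
  have hherm : Mᴴ = M := by
    ext k l
    rw [← sub_eq_zero]
    refine hinj _ fun i => ?_
    have := congrFun (congrFun (hM i).1 k) l
    simp only [Matrix.conjTranspose_apply, Matrix.map_apply] at this
    rw [Matrix.conjTranspose_apply, map_sub, map_star, this, sub_self]
  rw [mem_matrixCone_iff]
  have hs : IsSelfAdjoint (CStarMatrix.ofMatrix M) := hherm
  refine nonneg_of_isUnit_sub_smul_one _ hs fun r hlt => ?_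
  -- Over a commutative ring invertibility is read off the determinant. Each `F i` sends this
  -- determinant to that of a positive semidefinite matrix plus `-r > 0` times the identity, which
  -- is nonzero.
  have hU : IsUnit (M - Matrix.diagonal fun _ => algebraMap ℂ A (r : ℂ)) := by
    rw [Matrix.isUnit_iff_isUnit_det]
    refine hunit _ fun i => ?_
    have hdet : F i (M - Matrix.diagonal fun _ => algebraMap ℂ A (r : ℂ)).det =
        (M.map (F i) - Matrix.diagonal fun _ => (r : ℂ)).det := by
      have := RingHom.map_det (F i : A →+* ℂ) (M - Matrix.diagonal fun _ => algebraMap ℂ A (r : ℂ))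
      refine this.trans ?_
      congr 1
      ext k l
      by_cases hkl : k = l <;> simp [hkl, Matrix.diagonal, AlgHomClass.commutes]
    rw [hdet]
    have hpd : (M.map (F i) - Matrix.diagonal fun _ => (r : ℂ)).PosDef := by
      have h2 : (Matrix.diagonal fun _ : Fin n => (-r : ℂ)).PosDef := by
        refine Matrix.PosDef.diagonal fun _ => ?_
        rw [← Complex.ofReal_neg, Complex.zero_lt_real]
        linarith
      have := Matrix.PosDef.posSemidef_add (hM i) h2
      convert this using 1
      ext k l
      by_cases hkl : k = l <;> simp [hkl, Matrix.diagonal, sub_eq_add_neg]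
    exact ((Matrix.isUnit_iff_isUnit_det _).mp hpd.isUnit).ne_zero
  have h4 : ∀ z : ℂ, CStarMatrix.ofMatrix M - z • 1 =
      CStarMatrix.ofMatrix (M - Matrix.diagonal fun _ => algebraMap ℂ A z) := by
    intro z
    ext k l
    simp only [Algebra.algebraMap_eq_smul_one]
    by_cases hkl : k = l <;> simp [hkl, Matrix.diagonal]
  rw [h4]
  exact hU

theorem mem_matrixCone_of_character {A : Type*} [CommCStarAlgebra A] {n : ℕ}
    (M : Matrix (Fin n) (Fin n) A)
    (hM : ∀ χ : WeakDual.characterSpace ℂ A, (M.map χ).PosSemidef) : M ∈ matrixCone A n := by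
  refine mem_matrixCone_of_posSemidef
    (fun χ : WeakDual.characterSpace ℂ A => StarAlgHomClass.toStarAlgHom χ) ?_ ?_ M hM
  · intro a ha
    refine (gelfandTransform_isometry A).injective ?_
    rw [map_zero]
    ext χ
    exact ha χ
  · intro a ha
    by_contra h
    obtain ⟨χ, hχ⟩ := WeakDual.CharacterSpace.exists_apply_eq_zero h
    exact ha χ hχ

theorem ContinuousMap.mem_matrixCone_of_posSemidef {X : Type*} [TopologicalSpace X] [CompactSpace X]
    {n : ℕ} (M : Matrix (Fin n) (Fin n) C(X, ℂ))
    (hM : ∀ x : X, (M.map fun f => f x).PosSemidef) : M ∈ matrixCone C(X, ℂ) n := by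
  refine _root_.mem_matrixCone_of_posSemidef
    (fun x : X => ContinuousMap.evalStarAlgHom ℂ ℂ x) ?_ ?_ M hM
  · intro a ha
    ext x
    exact ha x
  · intro a ha
    exact (ContinuousMap.isUnit_iff_forall_ne_zero a).mpr ha

theorem posSemidef_map_of_mem_matrixCone {A : Type*} [CStarAlgebra A] (F : A →⋆ₐ[ℂ] ℂ) {n : ℕ}
    {M : Matrix (Fin n) (Fin n) A} (hM : M ∈ matrixCone A n) : (M.map F).PosSemidef := by
  obtain ⟨N, rfl⟩ := hM
  have : (Nᴴ * N).map F = (N.map F)ᴴ * N.map F := by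
    ext i j
    simp [Matrix.mul_apply, map_star]
  rw [this]
  exact Matrix.posSemidef_conjTranspose_mul_self _

end Characters

/-! ### The Choi–Effros product on the range of an idempotent -/

section ChoiEffros

variable {W : Type*} [CommCStarAlgebra W] {P : W →ₗ[ℂ] W}

theorem nonneg_of_forall_add_smul_nonneg [PartialOrder W] [StarOrderedRing W] {b q : W}
    (h : ∀ t : ℝ, 0 < t → 0 ≤ b + (t : ℂ) • q) : 0 ≤ b := by
  have hc : Continuous fun r : ℝ => b + (r : ℂ) • q := by fun_prop
  have ht := (hc.tendsto 0).mono_left (nhdsWithin_le_nhds (s := Set.Ioi 0))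
  have := CStarAlgebra.isClosed_nonneg.mem_of_tendsto ht
    (Filter.eventually_of_mem self_mem_nhdsWithin fun r hr => h r hr)
  simpa using this

/-- A unital completely positive idempotent `P` vanishes on the products of its kernel with its
range. -/
theorem IsUCP.map_mul_eq_zero (hP : IsUCP P) (hPP : P ∘ₗ P = P) {y c : W} (hy : P y = 0)
    (hc : P c = c) : P (y * c) = 0 := by
  let _ := CStarAlgebra.spectralOrder W
  have := CStarAlgebra.spectralOrderedRing W
  have hid : ∀ a, P (P a) = P a := fun a => LinearMap.congr_fun hPP a
  -- the real part of `P (y * c)` vanishes for all `y` in the kernel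
  have key : ∀ z : W, P z = 0 → 0 ≤ P (z * star c) + star (P (z * star c)) := by
    intro z hz
    refine nonneg_of_forall_add_smul_nonneg (q := P (star z * z)) fun t ht => ?_
    -- As `P (c + t z) = c`, applying `P` to the Schwarz inequality gives `P (c* c) ≤ P ((c + t z)*
    -- (c + t z))`. The terms free of `t` cancel; what remains is divided by `t`, and then `t → 0`.
    have h1 := hP.monotone (hP.schwarz (c + (t : ℂ) • z))
    rw [map_add P c, map_smul, hz, smul_zero, add_zero, hc, hid, ← sub_nonneg, ← map_sub] at h1
    have h2 : star (c + (t : ℂ) • z) * (c + (t : ℂ) • z) - star c * c =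
        (t : ℂ) • (z * star c + star (z * star c) + (t : ℂ) • (star z * z)) := by
      simp only [star_add, star_smul, star_mul, star_star, Complex.star_def, Complex.conj_ofReal,
        mul_add, add_mul, smul_mul_assoc, mul_smul_comm, mul_comm (star c) z, mul_comm c (star z)]
      module
    rw [h2, map_smul, Complex.coe_smul] at h1
    have h3 := smul_nonneg (inv_nonneg.mpr ht.le) h1
    rw [smul_smul, inv_mul_cancel₀ ht.ne', one_smul] at h3
    rwa [map_add, map_add, map_smul, hP.map_star (z * star c)] at h3
  have key' : ∀ z : W, P z = 0 → P (z * star c) + star (P (z * star c)) = 0 := by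
    intro z hz
    refine le_antisymm ?_ (key z hz)
    have := key (-z) (by simp [hz])
    rw [neg_mul, map_neg, star_neg, ← neg_add, neg_nonneg] at this
    exact this
  have key'' : ∀ z : W, P z = 0 → P (z * star c) = 0 := by
    intro z hz
    have h1 := key' z hz
    -- Replacing `z` by `i z` kills the imaginary part as well.
    have h2 := key' (Complex.I • z) (by simp [hz])
    simp only [smul_mul_assoc, map_smul, star_smul, Complex.star_def, Complex.conj_I] at h2
    have h3 := congrArg (-Complex.I • ·) h2
    simp only [smul_add, smul_smul, mul_neg, neg_mul, Complex.I_mul_I, neg_neg, one_smul,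
      smul_zero] at h3
    have h5 : (2 : ℂ) • P (z * star c) = (2 : ℂ) • (0 : W) := by
      linear_combination (norm := module) h1 + h3
    exact smul_right_injective W two_ne_zero h5
  have h := key'' (star y) (by rw [hP.map_star, hy, star_zero])
  rwa [← star_mul, hP.map_star, star_eq_zero, mul_comm] at h

/-- `P x - x` lies in the kernel of `P`. This identity carries associativity: an inner `P` may be
dropped inside a product with an element of the range. -/
theorem IsUCP.map_map_mul (hP : IsUCP P) (hPP : P ∘ₗ P = P) (x : W) {c : W} (hc : P c = c) :
    P (P x * c) = P (x * c) := by
  have := hP.map_mul_eq_zero hPP (y := P x - x) (c := c)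
    (by rw [map_sub, sub_eq_zero]; exact LinearMap.congr_fun hPP x) hc
  rwa [sub_mul, map_sub, sub_eq_zero] at this

/-- The range of a unital completely positive idempotent `P` on a commutative C*-algebra, to be
endowed with the Choi–Effros product `P (a * b)`. -/
@[nolint unusedArguments]
def ChoiEffros (P : W →ₗ[ℂ] W) (_ : IsUCP P) (_ : P ∘ₗ P = P) : Type _ := LinearMap.range P

namespace ChoiEffros

variable (hP : IsUCP P) (hPP : P ∘ₗ P = P)

instance : NormedAddCommGroup (ChoiEffros P hP hPP) :=
  inferInstanceAs (NormedAddCommGroup (LinearMap.range P))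

instance : NormedSpace ℂ (ChoiEffros P hP hPP) :=
  inferInstanceAs (NormedSpace ℂ (LinearMap.range P))

/-- The inclusion of the range of `P`. -/
def incl : ChoiEffros P hP hPP →ₗ[ℂ] W := (LinearMap.range P).subtype

/-- The corestriction of `P` to its range. -/
def proj : W →ₗ[ℂ] ChoiEffros P hP hPP := P.rangeRestrict

variable {hP hPP}

theorem incl_injective : Function.Injective (incl hP hPP) := Subtype.val_injective

theorem map_incl (a : ChoiEffros P hP hPP) : P (incl hP hPP a) = incl hP hPP a := by
  obtain ⟨_, x, rfl⟩ := a
  exact LinearMap.congr_fun hPP x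

theorem norm_incl (a : ChoiEffros P hP hPP) : ‖incl hP hPP a‖ = ‖a‖ := rfl

instance : Mul (ChoiEffros P hP hPP) := ⟨fun a b => proj hP hPP (incl hP hPP a * incl hP hPP b)⟩
instance : One (ChoiEffros P hP hPP) := ⟨proj hP hPP 1⟩
instance : Star (ChoiEffros P hP hPP) := ⟨fun a => proj hP hPP (star (incl hP hPP a))⟩

theorem incl_mul (a b : ChoiEffros P hP hPP) :
    incl hP hPP (a * b) = P (incl hP hPP a * incl hP hPP b) := rfl

theorem incl_one : incl hP hPP 1 = 1 := hP.map_unit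

theorem incl_star (a : ChoiEffros P hP hPP) : incl hP hPP (star a) = star (incl hP hPP a) := by
  change P _ = _
  rw [hP.map_star, map_incl]

instance : NormedCommRing (ChoiEffros P hP hPP) where
  __ := (inferInstance : NormedAddCommGroup (ChoiEffros P hP hPP))
  left_distrib a b c := incl_injective (by simp only [incl_mul, map_add, mul_add])
  right_distrib a b c := incl_injective (by simp only [incl_mul, map_add, add_mul])
  zero_mul a := incl_injective (by simp only [incl_mul, map_zero, zero_mul])
  mul_zero a := incl_injective (by simp only [incl_mul, map_zero, mul_zero])
  mul_assoc a b c := incl_injective (by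
    -- Both bracketings reduce to `P (a * b * c)`.
    simp only [incl_mul]
    rw [hP.map_map_mul hPP _ (map_incl c), mul_comm (incl hP hPP a) (P _),
      hP.map_map_mul hPP _ (map_incl a)]
    congr 1
    ring)
  one_mul a := incl_injective (by rw [incl_mul, incl_one, one_mul, map_incl])
  mul_one a := incl_injective (by rw [incl_mul, incl_one, mul_one, map_incl])
  mul_comm a b := incl_injective (by rw [incl_mul, incl_mul, mul_comm])
  norm_mul_le a b := by
    rw [← norm_incl, ← norm_incl, ← norm_incl, incl_mul]
    exact (hP.norm_le _).trans (norm_mul_le _ _)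

instance : StarRing (ChoiEffros P hP hPP) where
  star_involutive a := incl_injective (by simp only [incl_star, star_star])
  star_mul a b := incl_injective (by
    simp only [incl_star, incl_mul]
    rw [← hP.map_star, star_mul])
  star_add a b := incl_injective (by simp only [incl_star, map_add, star_add])

instance : NormedAlgebra ℂ (ChoiEffros P hP hPP) where
  __ := Algebra.ofModule (R := ℂ) (A := ChoiEffros P hP hPP)
    (fun r a b => incl_injective (by simp only [incl_mul, map_smul, smul_mul_assoc]))
    (fun r a b => incl_injective (by simp only [incl_mul, map_smul, mul_smul_comm]))
  norm_smul_le := norm_smul_le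

instance : StarModule ℂ (ChoiEffros P hP hPP) where
  star_smul r a := incl_injective (by simp only [incl_star, map_smul, star_smul])

/-- The Schwarz inequality at a fixed point reads `a* a ≤ P (a* a)` in `W`, and the norm is monotone
on positive elements. -/
instance : CStarRing (ChoiEffros P hP hPP) where
  norm_mul_self_le a := by
    let _ := CStarAlgebra.spectralOrder W
    have := CStarAlgebra.spectralOrderedRing W
    rw [← norm_incl, ← norm_incl (star a * a), incl_mul, incl_star, ← CStarRing.norm_star_mul_self]
    have := hP.schwarz (incl hP hPP a)
    rw [map_incl] at this
    exact CStarAlgebra.norm_le_norm_of_nonneg_of_le (star_mul_self_nonneg _) this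

/-- The range is the fixed-point set of the contraction `P`, hence closed. -/
instance : CompleteSpace (ChoiEffros P hP hPP) := by
  have hc : Continuous P :=
    AddMonoidHomClass.continuous_of_bound P 1 fun x => by simpa using hP.norm_le x
  have : IsClosed (LinearMap.range P : Set W) := by
    have : (LinearMap.range P : Set W) = {x | P x = x} := by
      ext x
      exact ⟨fun ⟨y, hy⟩ => hy ▸ LinearMap.congr_fun hPP y, fun h => ⟨x, h⟩⟩
    rw [this]
    exact isClosed_eq hc continuous_id
  exact this.completeSpace_coe

instance : CommCStarAlgebra (ChoiEffros P hP hPP) where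

/-- Characters of the Choi–Effros algebra are positive for the order of the ambient algebra. -/
theorem character_nonneg (χ : WeakDual.characterSpace ℂ (ChoiEffros P hP hPP))
    {a : ChoiEffros P hP hPP} (ha : IsPositiveElement (incl hP hPP a)) : 0 ≤ χ a := by
  let _ := CStarAlgebra.spectralOrder W
  have := CStarAlgebra.spectralOrderedRing W
  rw [isPositiveElement_iff_nonneg] at ha
  set c : ℝ := ‖a‖ with hc
  have hsa : star a = a :=
    incl_injective (by rw [incl_star]; exact IsSelfAdjoint.of_nonneg ha)
  -- The two algebras share their norm and unit, and `0 ≤ a ≤ c` in `W` gives this bound. Since `χ`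
  -- is contractive, the real number `χ a` satisfies `|c - χ a| ≤ c`, so it is nonnegative.
  have h1 : ‖(c : ℂ) • 1 - a‖ ≤ c := by
    rw [← norm_incl, map_sub, map_smul, incl_one]
    have h2 : incl hP hPP a ≤ algebraMap ℝ W c :=
      (CStarAlgebra.norm_le_iff_le_algebraMap _ (norm_nonneg _) ha).mp le_rfl
    have h3 : algebraMap ℝ W c = (c : ℂ) • (1 : W) := by
      rw [Algebra.algebraMap_eq_smul_one, Complex.coe_smul]
    rw [h3] at h2
    rw [CStarAlgebra.norm_le_iff_le_algebraMap _ (norm_nonneg _) (sub_nonneg.mpr h2), h3]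
    exact sub_le_self _ ha
  have : Nontrivial (ChoiEffros P hP hPP) :=
    ⟨0, 1, fun h => zero_ne_one (α := ℂ) (by simpa using congrArg χ h)⟩
  have h4 : ‖χ ((c : ℂ) • 1 - a)‖ ≤ c :=
    (spectrum.norm_le_norm_of_mem (AlgHom.apply_mem_spectrum χ _)).trans h1
  have h5 : star (χ a) = χ a := by rw [← map_star, hsa]
  rw [map_sub, map_smul, map_one, smul_eq_mul, mul_one] at h4
  have h6 : ((χ a).re : ℂ) = χ a := Complex.conj_eq_iff_re.mp h5
  rw [← h6] at h4 ⊢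
  rw [← Complex.ofReal_sub, Complex.norm_real, Real.norm_eq_abs] at h4
  rw [Complex.zero_le_real]
  linarith [(abs_le.mp h4).2]

end ChoiEffros

end ChoiEffros

/-! ### Retracts of commutative C*-algebras -/

section ChoiEffros

theorem comp_idempotent {E W : Type*} [AddCommGroup E] [Module ℂ E] [AddCommGroup W] [Module ℂ W]
    {θ : E →ₗ[ℂ] W} {ψ : W →ₗ[ℂ] E} (h : ψ ∘ₗ θ = LinearMap.id) :
    (θ ∘ₗ ψ) ∘ₗ (θ ∘ₗ ψ) = θ ∘ₗ ψ := by
  rw [LinearMap.comp_assoc, ← LinearMap.comp_assoc ψ θ ψ, h, LinearMap.id_comp]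

variable {E W : Type*} [AddCommGroup E] [Module ℂ E] [StarAddMonoid E] [StarModule ℂ E]
  [OperatorSystem E] [CommCStarAlgebra W] {θ : E →ₗ[ℂ] W} {ψ : W →ₗ[ℂ] E}

/-- A retract of a commutative C*-algebra is identified with a Choi–Effros algebra. -/
def retractEquiv (hθ : IsUCP θ) (hψ : IsUCP ψ) (h : ψ ∘ₗ θ = LinearMap.id) :
    E ≃ₗ[ℂ] ChoiEffros (θ ∘ₗ ψ) (hθ.comp hψ) (comp_idempotent h) where
  __ := ChoiEffros.proj (hθ.comp hψ) (comp_idempotent h) ∘ₗ θ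
  invFun a := ψ (ChoiEffros.incl _ _ a)
  left_inv x := by
    change ψ (θ (ψ (θ x))) = x
    have hid : ∀ x, ψ (θ x) = x := fun x => LinearMap.congr_fun h x
    rw [hid, hid]
  right_inv a := by
    refine ChoiEffros.incl_injective ?_
    change θ (ψ (θ (ψ (ChoiEffros.incl _ _ a)))) = _
    have := ChoiEffros.map_incl a
    simp only [LinearMap.comp_apply] at this
    rw [this, this]

variable (hθ : IsUCP θ) (hψ : IsUCP ψ) (h : ψ ∘ₗ θ = LinearMap.id)

theorem incl_retractEquiv (x : E) : ChoiEffros.incl _ _ (retractEquiv hθ hψ h x) = θ x := by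
  change θ (ψ (θ x)) = θ x
  rw [← LinearMap.comp_apply ψ, h, LinearMap.id_apply]

theorem retractEquiv_symm_apply (a) :
    (retractEquiv hθ hψ h).symm a = ψ (ChoiEffros.incl _ _ a) := rfl

/-- Forward, characters pull back to positive functionals on `E`, which are automatically completely
positive. Backward, `N* N` for the Choi–Effros product is `θ ∘ ψ` of the product `N* N` in `W`, so
its preimage in `E` is `ψ` of a positive matrix. -/
theorem isCompleteOrderEmbedding_retractEquiv :
    IsCompleteOrderEmbedding (retractEquiv hθ hψ h).toLinearMap where
  map_unit := ChoiEffros.incl_injective (by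
    rw [LinearEquiv.coe_coe, incl_retractEquiv, hθ.map_unit]
    exact ChoiEffros.incl_one.symm)
  map_mem n M hM := by
    refine mem_matrixCone_of_character _ fun χ => ?_
    exact posSemidef_map_of_isPositiveElement
      (f := (WeakDual.CharacterSpace.toAlgHom χ).toLinearMap ∘ₗ (retractEquiv hθ hψ h).toLinearMap)
      (fun x hx => ChoiEffros.character_nonneg χ (by
        rw [LinearEquiv.coe_coe, incl_retractEquiv]
        exact hθ.isPositiveElement hx)) hM
  reflects n M := by
    rintro ⟨N, hN⟩
    have hM : M = ((N.map (ChoiEffros.incl _ _))ᴴ * N.map (ChoiEffros.incl _ _)).map ψ := by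
      ext i j
      have hij := congrFun (congrFun hN i) j
      rw [Matrix.map_apply, LinearEquiv.coe_coe, ← LinearEquiv.eq_symm_apply,
        retractEquiv_symm_apply] at hij
      rw [hij]
      simp only [Matrix.mul_apply, Matrix.map_apply, Matrix.conjTranspose_apply, map_sum,
        ChoiEffros.incl_mul, ChoiEffros.incl_star, LinearMap.comp_apply]
      exact Finset.sum_congr rfl fun k _ => LinearMap.congr_fun h _
    rw [hM]
    exact hψ.map_mem n _ ⟨_, rfl⟩

end ChoiEffros

/-! ### Extension and boundedness of states -/

section States

variable {V S : Type*} [AddCommGroup V] [Module ℂ V] [StarAddMonoid V] [StarModule ℂ V]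
  [OperatorSystem V] [AddCommGroup S] [Module ℂ S] [StarAddMonoid S] [StarModule ℂ S]
  [OperatorSystem S]

theorem isPositiveElement_zero : IsPositiveElement (0 : V) := by
  simpa using isPositiveElement_smul_unit (V := V) le_rfl

theorem IsCompleteOrderEmbedding.isPositiveElement_iff {j : S →ₗ[ℂ] V}
    (hj : IsCompleteOrderEmbedding j) {x : S} : IsPositiveElement (j x) ↔ IsPositiveElement x :=
  ⟨hj.reflects 1 _, hj.map_mem 1 _⟩

theorem IsCompleteOrderEmbedding.injective {j : S →ₗ[ℂ] V} (hj : IsCompleteOrderEmbedding j) :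
    Function.Injective j := by
  rw [injective_iff_map_eq_zero]
  intro x hx
  have h1 : IsPositiveElement x := by
    rw [← hj.isPositiveElement_iff, hx]; exact isPositiveElement_zero
  have h2 : IsPositiveElement (-x) := by
    rw [← hj.isPositiveElement_iff, map_neg, hx, neg_zero]; exact isPositiveElement_zero
  exact congrFun (congrFun (OperatorSystem.eq_zero h1 h2) 0) 0

/-- The elements of an operator system with positive real part. -/
def positiveRealPart (V : Type*) [AddCommGroup V] [Module ℂ V] [StarAddMonoid V] [StarModule ℂ V]
    [OperatorSystem V] : PointedCone ℝ V where
  carrier := {x | IsPositiveElement (x + star x)}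
  add_mem' {x y} hx hy := by
    have := hx.add hy
    rw [Set.mem_ofPred_eq, star_add, add_add_add_comm]
    exact this
  zero_mem' := by
    rw [Set.mem_ofPred_eq, star_zero, add_zero]
    exact isPositiveElement_zero
  smul_mem' c x hx := by
    have := IsPositiveElement.smul (V := V) hx c.2
    rw [Set.mem_ofPred_eq]
    convert this using 1
    change ((c : ℝ) : ℂ) • x + star (((c : ℝ) : ℂ) • x) = ((c : ℝ) : ℂ) • (x + star x)
    rw [star_smul, smul_add, Complex.star_def, Complex.conj_ofReal]

theorem mem_positiveRealPart {x : V} : x ∈ positiveRealPart V ↔ IsPositiveElement (x + star x) :=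
  Iff.rfl

/-- Positive functionals extend along complete order embeddings. -/
theorem IsCompleteOrderEmbedding.exists_extension {j : S →ₗ[ℂ] V}
    (hj : IsCompleteOrderEmbedding j) (f : S →ₗ[ℂ] ℂ) (hf : ∀ x, IsPositiveElement x → 0 ≤ f x) :
    ∃ F : V →ₗ[ℂ] ℂ, (∀ x, IsPositiveElement x → 0 ≤ F x) ∧ ∀ x, F (j x) = f x := by
  have hfs := map_star_of_isPositiveElement f fun x hx => Complex.star_eq_of_nonneg (hf x hx)
  let eqv := LinearEquiv.ofInjective j hj.injective
  -- M. Riesz extension is applied to the real part of `f`, with the cone of elements of positive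
  -- real part, so that it can be run on all of `V` and not only on its hermitian elements.
  let f₀ : V →ₗ.[ℝ] ℝ :=
    { domain := (LinearMap.range j).restrictScalars ℝ
      toFun := Complex.reLm ∘ₗ (f ∘ₗ eqv.symm.toLinearMap).restrictScalars ℝ }
  have hf₀ : ∀ x : f₀.domain, ∃ s, j s = x ∧ f₀ x = (f s).re := by
    intro x
    refine ⟨eqv.symm x, ?_, rfl⟩
    exact congrArg Subtype.val (eqv.apply_symm_apply x)
  obtain ⟨g, hg1, hg2⟩ := riesz_extension (positiveRealPart V) f₀ (by
    intro x hx
    obtain ⟨s, hs, hfx⟩ := hf₀ x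
    rw [hfx]
    rw [← hs, mem_positiveRealPart, ← hj.map_star, ← map_add, hj.isPositiveElement_iff] at hx
    have := (Complex.nonneg_iff.mp (hf _ hx)).1
    rw [map_add, hfs, Complex.star_def, Complex.add_re, Complex.conj_re] at this
    linarith) (by
    intro y
    -- Cofinality: `(r / 2) • 1 + y` has `r • 1 + (y + y*)` as its sum with its adjoint.
    obtain ⟨r, hr, hp⟩ := exists_smul_unit_add_isPositiveElement (x := y + star y)
      (by rw [star_add, star_star, add_comm])
    refine ⟨⟨((r / 2 : ℝ) : ℂ) • OperatorSystem.unit,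
      ((r / 2 : ℝ) : ℂ) • OperatorSystem.unit, by rw [map_smul, hj.map_unit]⟩, ?_⟩
    rw [mem_positiveRealPart]
    convert hp using 1
    simp only [star_add, star_smul, star_unit, Complex.star_def, Complex.conj_ofReal]
    push_cast
    module)
  have hgj : ∀ s, g (j s) = (f s).re := by
    intro s
    have hmem : j s ∈ f₀.domain := ⟨s, rfl⟩
    obtain ⟨t, ht, hft⟩ := hf₀ ⟨j s, hmem⟩
    rw [hg1 ⟨j s, hmem⟩, hft, hj.injective ht]
  -- The complex functional with real part `g` is `x ↦ g x - i g (i x)`. For positive `x`, both `i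
  -- x` and `-i x` have real part zero and so lie in the cone, which forces `g (i x) = 0`.
  refine ⟨Module.Dual.extendRCLike g, ?_, ?_⟩
  · intro x hx
    have h1 : 0 ≤ g x := hg2 x (by rw [mem_positiveRealPart, hx.star_eq]; exact hx.add hx)
    have hz : ∀ c : ℂ, star c = -c → 0 ≤ g (c • x) := by
      intro c hc
      refine hg2 _ ?_
      rw [mem_positiveRealPart, star_smul, hx.star_eq, hc, neg_smul, add_neg_cancel]
      exact isPositiveElement_zero
    have h2 := hz Complex.I (by simp)
    have h3 := hz (-Complex.I) (by simp)
    rw [neg_smul, map_neg] at h3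
    rw [Complex.nonneg_iff]
    rw [Module.Dual.extendRCLike_apply]
    have h4 : g (Complex.I • x) = 0 := le_antisymm (by linarith) h2
    constructor
    · simpa [h4] using h1
    · simp [h4]
  · intro s
    have h2 : g (Complex.I • j s) = -(f s).im := by
      rw [← map_smul, hgj, map_smul, smul_eq_mul, Complex.I_mul_re]
    rw [Module.Dual.extendRCLike_apply]
    refine Complex.ext ?_ ?_
    · simp [h2, hgj]
    · simp [h2, hgj]

/-- Unital positive functionals are uniformly bounded at every element. -/
theorem exists_bound_of_states (x : V) : ∃ C : ℝ, ∀ f : V →ₗ[ℂ] ℂ,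
    (∀ y, IsPositiveElement y → 0 ≤ f y) → f OperatorSystem.unit = 1 → ‖f x‖ ≤ C := by
  have key : ∀ y : V, star y = y → ∃ C : ℝ, ∀ f : V →ₗ[ℂ] ℂ,
      (∀ y, IsPositiveElement y → 0 ≤ f y) → f OperatorSystem.unit = 1 → ‖f y‖ ≤ C := by
    intro y hy
    obtain ⟨r, hr, h1⟩ := exists_smul_unit_add_isPositiveElement hy
    obtain ⟨s, hs, h2⟩ := exists_smul_unit_add_isPositiveElement (x := -y) (by rw [star_neg, hy])
    refine ⟨r + s, fun f hf hf1 => ?_⟩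
    have e1 := hf _ h1
    have e2 := hf _ h2
    rw [map_add, map_smul, hf1, smul_eq_mul, mul_one, Complex.nonneg_iff] at e1 e2
    simp only [Complex.add_re, Complex.add_im, Complex.ofReal_re, Complex.ofReal_im, map_neg,
      Complex.neg_re, zero_add] at e1 e2
    have e3 : f y = ((f y).re : ℂ) := Complex.ext rfl (by simpa using e1.2.symm)
    rw [e3, Complex.norm_real, Real.norm_eq_abs, abs_le]
    constructor <;> linarith [e1.1, e2.1]
  obtain ⟨C, hC⟩ := key (x + star x) (by rw [star_add, star_star, add_comm])
  obtain ⟨D, hD⟩ := key (Complex.I • (x - star x)) (by simp [star_smul, ← smul_neg])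
  refine ⟨C + D, fun f hf hf1 => ?_⟩
  have h1 := hC f hf hf1
  have h2 := hD f hf hf1
  have h3 : (2 : ℂ) * f x = f (x + star x) + -Complex.I * f (Complex.I • (x - star x)) := by
    rw [map_smul, smul_eq_mul, ← mul_assoc, neg_mul, Complex.I_mul_I, neg_neg, one_mul, map_add,
      map_sub]
    ring
  have h4 := norm_add_le (f (x + star x)) (-Complex.I * f (Complex.I • (x - star x)))
  rw [← h3, norm_mul, norm_mul, norm_neg, Complex.norm_I, one_mul, Complex.norm_ofNat] at h4
  linarith [norm_nonneg (f x)]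

end States

/-! ### Bounded functions and the translation action -/

section BoundedFunctions

variable {I : Type*} {V : Type*} [AddCommGroup V] [Module ℂ V] [StarAddMonoid V] [StarModule ℂ V]
  [OperatorSystem V]

/-- A pointwise factorization `N i* N i` suffices: diagonal entries of `M` dominate the squares of
the entries of `N i`, so the chosen factors are bounded in `i`. -/
theorem lp.mem_matrixCone_iff {n : ℕ} {M : Matrix (Fin n) (Fin n) (lp (fun _ : I => ℂ) ∞)} :
    M ∈ matrixCone (lp (fun _ : I => ℂ) ∞) n ↔
      ∀ i, (M.map fun f => (f i : ℂ)).PosSemidef := by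
  constructor
  · rintro ⟨N, rfl⟩ i
    have : (Nᴴ * N).map (fun f => (f i : ℂ)) =
        (N.map fun f => (f i : ℂ))ᴴ * N.map fun f => (f i : ℂ) := by
      ext k l
      simp only [Matrix.mul_apply, Matrix.map_apply, Matrix.conjTranspose_apply]
      rw [lp.coeFn_sum, Finset.sum_apply]
      rfl
    rw [this]
    exact Matrix.posSemidef_conjTranspose_mul_self _
  · intro h
    have hN : ∀ i, ∃ N : Matrix (Fin n) (Fin n) ℂ, M.map (fun f => (f i : ℂ)) = Nᴴ * N :=
      fun i => by
        open scoped MatrixOrder Matrix.Norms.L2Operator in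
        exact CStarAlgebra.nonneg_iff_eq_star_mul_self.mp (h i).nonneg
    choose N hN using hN
    have hbound : ∀ i k l, ‖N i k l‖ ^ 2 ≤ ‖M l l‖ := by
      intro i k l
      have h1 : (M l l : I → ℂ) i = ((∑ m, ‖N i m l‖ ^ 2 : ℝ) : ℂ) := by
        have := congrFun (congrFun (hN i) l) l
        simp only [Matrix.map_apply, Matrix.mul_apply, Matrix.conjTranspose_apply,
          Complex.star_def, Complex.conj_mul'] at this
        rw [this]
        push_cast
        rfl
      have h2 := lp.norm_apply_le_norm ENNReal.top_ne_zero (M l l) i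
      rw [h1, Complex.norm_real, Real.norm_eq_abs] at h2
      refine le_trans ?_ ((le_abs_self _).trans h2)
      exact Finset.single_le_sum (f := fun m => ‖N i m l‖ ^ 2) (fun m _ => by positivity)
        (Finset.mem_univ k)
    refine ⟨Matrix.of fun k l => ⟨fun i => N i k l, memℓp_infty ⟨√‖M l l‖, ?_⟩⟩, ?_⟩
    · rintro _ ⟨i, rfl⟩
      exact Real.le_sqrt_of_sq_le (hbound i k l)
    · ext k l i
      have := congrFun (congrFun (hN i) k) l
      rw [Matrix.map_apply] at this
      rw [this]
      simp only [Matrix.mul_apply, Matrix.conjTranspose_apply]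
      rw [lp.coeFn_sum, Finset.sum_apply]
      rfl

/-- The map into the bounded functions given by a family of states. -/
def statesMap (F : I → V →ₗ[ℂ] ℂ) (hF : ∀ i x, IsPositiveElement x → 0 ≤ F i x)
    (hF1 : ∀ i, F i OperatorSystem.unit = 1) : V →ₗ[ℂ] lp (fun _ : I => ℂ) ∞ where
  toFun x := ⟨fun i => F i x, by
    obtain ⟨C, hC⟩ := exists_bound_of_states x
    refine memℓp_infty ⟨C, ?_⟩
    rintro _ ⟨i, rfl⟩
    exact hC _ (hF i) (hF1 i)⟩
  map_add' x y := lp.ext (funext fun i => map_add (F i) x y)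
  map_smul' c x := lp.ext (funext fun i => map_smul (F i) c x)

theorem statesMap_apply (F : I → V →ₗ[ℂ] ℂ) (hF : ∀ i x, IsPositiveElement x → 0 ≤ F i x)
    (hF1 : ∀ i, F i OperatorSystem.unit = 1) (x : V) (i : I) : statesMap F hF hF1 x i = F i x := rfl

theorem isUCP_statesMap (F : I → V →ₗ[ℂ] ℂ) (hF : ∀ i x, IsPositiveElement x → 0 ≤ F i x)
    (hF1 : ∀ i, F i OperatorSystem.unit = 1) : IsUCP (statesMap F hF hF1) where
  map_unit := lp.ext (funext fun i => hF1 i)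
  map_mem _ _ hM := lp.mem_matrixCone_iff.mpr fun i => posSemidef_map_of_isPositiveElement (hF i) hM

variable {G : Type*} [Group G] {Y : Type*}

/-- The left translation action of `G` on the bounded functions on `G × Y`. -/
instance lp.translationAction : DistribMulAction G (lp (fun _ : G × Y => ℂ) ∞) where
  smul g f := ⟨fun p => f (g⁻¹ * p.1, p.2), by
    refine memℓp_infty ⟨‖f‖, ?_⟩
    rintro _ ⟨p, rfl⟩
    exact lp.norm_apply_le_norm ENNReal.top_ne_zero f _⟩
  one_smul f := lp.ext (funext fun p => by
    change f (1⁻¹ * p.1, p.2) = f p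
    rw [inv_one, one_mul])
  mul_smul g h f := lp.ext (funext fun p => by
    change f ((g * h)⁻¹ * p.1, p.2) = f (h⁻¹ * (g⁻¹ * p.1), p.2)
    rw [mul_inv_rev, mul_assoc])
  smul_zero _ := rfl
  smul_add _ _ _ := rfl

theorem lp.translation_apply (g : G) (f : lp (fun _ : G × Y => ℂ) ∞) (p : G × Y) :
    (g • f) p = f (g⁻¹ * p.1, p.2) := rfl

instance lp.translationSMulComm : SMulCommClass G ℂ (lp (fun _ : G × Y => ℂ) ∞) where
  smul_comm _ _ _ := rfl

instance lp.translationIsGOperatorSystem : IsGOperatorSystem G (lp (fun _ : G × Y => ℂ) ∞) where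
  smul_unit _ := rfl
  smul_mem g _ _ hM := lp.mem_matrixCone_iff.mpr fun p =>
    lp.mem_matrixCone_iff.mp hM (g⁻¹ * p.1, p.2)

end BoundedFunctions

/-! ### Embedding `C(X)` in the bounded functions and retracting onto the envelope -/

section GSpace

instance ULift.continuousConstSMul_right {G X : Type*} [TopologicalSpace X] [SMul G X]
    [ContinuousConstSMul G X] : ContinuousConstSMul G (ULift X) where
  continuous_const_smul g :=
    continuous_uliftUp.comp ((continuous_const_smul g).comp continuous_uliftDown)

theorem StarAlgHom.isUCP {A B : Type*} [CStarAlgebra A] [CStarAlgebra B] (f : A →⋆ₐ[ℂ] B) :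
    IsUCP f.toLinearMap where
  map_unit := map_one f
  map_mem n M := by
    rintro ⟨N, rfl⟩
    refine ⟨N.map f, ?_⟩
    ext i j
    simp [Matrix.mul_apply, map_star]

variable {G : Type*} [Group G] {X : Type*} [TopologicalSpace X]

/-- Evaluation at a point as a linear functional. -/
def evalFunctional (x : X) : C(X, ℂ) →ₗ[ℂ] ℂ := (ContinuousMap.evalStarAlgHom ℂ ℂ x).toLinearMap

theorem evalFunctional_apply (x : X) (f : C(X, ℂ)) : evalFunctional x f = f x := rfl

variable [CompactSpace X]

theorem evalFunctional_nonneg (x : X) (f : C(X, ℂ)) (hf : IsPositiveElement f) :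
    0 ≤ evalFunctional x f := by
  obtain ⟨b, rfl⟩ := isPositiveElement_iff_exists.mp hf
  exact star_mul_self_nonneg (b x)

variable [MulAction G X]

variable (G X) in
/-- The map `f ↦ ((g, x) ↦ f (g • x))` from the continuous functions on `X` to the bounded
functions on `G × X`. -/
def orbitMap : C(X, ℂ) →ₗ[ℂ] lp (fun _ : G × X => ℂ) ∞ :=
  statesMap (fun p : G × X => evalFunctional (p.1 • p.2))
    (fun p => evalFunctional_nonneg (p.1 • p.2)) (fun _ => rfl)

theorem orbitMap_apply (f : C(X, ℂ)) (p : G × X) : orbitMap G X f p = f (p.1 • p.2) := rfl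

theorem orbitMap_mul (f h : C(X, ℂ)) : orbitMap G X (f * h) = orbitMap G X f * orbitMap G X h :=
  rfl

theorem isCompleteOrderEmbedding_orbitMap : IsCompleteOrderEmbedding (orbitMap G X) where
  toIsUCP := isUCP_statesMap _ _ _
  reflects n M hM := ContinuousMap.mem_matrixCone_of_posSemidef M fun x => by
    have := lp.mem_matrixCone_iff.mp hM ((1 : G), x)
    convert this using 1
    ext k l
    simp only [Matrix.map_apply, orbitMap_apply, one_smul]

variable [ContinuousConstSMul G X]

theorem isGEquivariant_orbitMap : IsGEquivariant G (orbitMap G X) := fun g f =>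
  lp.ext (funext fun p => by
    rw [lp.translation_apply, orbitMap_apply, orbitMap_apply, ContinuousMap.gAction_apply,
      smul_smul])

variable {E : Type*} [AddCommGroup E] [Module ℂ E] [StarAddMonoid E] [StarModule ℂ E]
  [OperatorSystem E] [DistribMulAction G E] [SMulCommClass G ℂ E] [IsGOperatorSystem G E]

theorem isUCP_smul (g : G) : IsUCP (DistribSMul.toLinearMap ℂ E g) where
  map_unit := IsGOperatorSystem.smul_unit g
  map_mem := IsGOperatorSystem.smul_mem g

/-- The embedding of `C(X)` into the bounded functions on `G × X` extends along every equivariant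
complete order embedding of `C(X)`. -/
theorem exists_extension_orbitMap {j : C(X, ℂ) →ₗ[ℂ] E} (hj : IsCompleteOrderEmbedding j)
    (hjG : IsGEquivariant G j) :
    ∃ θ : E →ₗ[ℂ] lp (fun _ : G × X => ℂ) ∞,
      IsUCP θ ∧ IsGEquivariant G θ ∧ ∀ f, θ (j f) = orbitMap G X f := by
  choose s hs hsj using fun x : X =>
    hj.exists_extension (evalFunctional x) (evalFunctional_nonneg x)
  have hs1 : ∀ x, s x OperatorSystem.unit = 1 := fun x => by
    rw [← hj.map_unit, hsj]
    rfl
  -- The states `s x` are chosen without regard to the action; translating by `g⁻¹` at `(g, x)`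
  -- makes the resulting map equivariant.
  let F : G × X → E →ₗ[ℂ] ℂ := fun p => s p.2 ∘ₗ DistribSMul.toLinearMap ℂ E p.1⁻¹
  have hF : ∀ p y, IsPositiveElement y → 0 ≤ F p y := fun p y hy =>
    hs _ _ ((isUCP_smul p.1⁻¹).isPositiveElement hy)
  have hF1 : ∀ p, F p OperatorSystem.unit = 1 := fun p => by
    change s p.2 (p.1⁻¹ • OperatorSystem.unit) = 1
    rw [IsGOperatorSystem.smul_unit, hs1]
  refine ⟨statesMap F hF hF1, isUCP_statesMap _ _ _, fun g x => lp.ext (funext fun p => ?_),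
    fun f => lp.ext (funext fun p => ?_)⟩
  · rw [lp.translation_apply, statesMap_apply, statesMap_apply]
    change s p.2 (p.1⁻¹ • g • x) = s p.2 ((g⁻¹ * p.1)⁻¹ • x)
    rw [mul_inv_rev, inv_inv, mul_smul]
  · rw [statesMap_apply, orbitMap_apply]
    change s p.2 (p.1⁻¹ • j f) = _
    rw [← hjG, hsj, evalFunctional_apply, ContinuousMap.gAction_apply, inv_inv]

end GSpace

/-- The injective envelope of `C(X)` is an equivariant retract of the bounded functions on
`G × X`. -/
theorem IsGInjectiveEnvelope.exists_retraction {G : Type u} [Group G] {X : Type v}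
    [TopologicalSpace X] [CompactSpace X] [MulAction G X] [ContinuousConstSMul G X]
    {E : Type (max u v)} [AddCommGroup E] [Module ℂ E] [StarAddMonoid E] [StarModule ℂ E]
    [OperatorSystem E] [DistribMulAction G E] [SMulCommClass G ℂ E] [IsGOperatorSystem G E]
    {j : C(X, ℂ) →ₗ[ℂ] E} (hE : IsGInjectiveEnvelope G j) :
    ∃ (θ : E →ₗ[ℂ] lp (fun _ : G × X => ℂ) ∞) (ψ : lp (fun _ : G × X => ℂ) ∞ →ₗ[ℂ] E),
      IsUCP θ ∧ IsUCP ψ ∧ ψ ∘ₗ θ = LinearMap.id ∧ ∀ f, θ (j f) = orbitMap G X f := by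
  obtain ⟨θ, hθ, hθG, hθj⟩ := exists_extension_orbitMap hE.embedding hE.equivariant
  -- Injectivity of `E` is tested in the universe of `E`, so `C(X)` is replaced by its copy `C(ULift
  -- X)`.
  let up : C(X, ULift.{u} X) := ⟨ULift.up, continuous_uliftUp⟩
  let down : C(ULift.{u} X, X) := ⟨ULift.down, continuous_uliftDown⟩
  let d : C(ULift.{u} X, ℂ) →⋆ₐ[ℂ] C(X, ℂ) := ContinuousMap.compStarAlgHom' ℂ ℂ up
  have hdG : IsGEquivariant G d.toLinearMap := fun _ _ => rfl
  have hi : IsCompleteOrderEmbedding (orbitMap G X ∘ₗ d.toLinearMap) :=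
    { toIsUCP := (isCompleteOrderEmbedding_orbitMap (G := G) (X := X)).toIsUCP.comp d.isUCP
      reflects := fun n M hM => by
        have := (isCompleteOrderEmbedding_orbitMap (G := G) (X := X)).reflects n (M.map d) hM
        refine ContinuousMap.mem_matrixCone_of_posSemidef M fun x => ?_
        exact posSemidef_map_of_mem_matrixCone (ContinuousMap.evalStarAlgHom ℂ ℂ x.down) this }
  obtain ⟨ψ, hψ, hψG, hψj⟩ := hE.injective C(ULift.{u} X, ℂ) (lp (fun _ : G × X => ℂ) ∞)
    (orbitMap G X ∘ₗ d.toLinearMap) (j ∘ₗ d.toLinearMap) hi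
    (fun g x => by
      rw [LinearMap.comp_apply, hdG, isGEquivariant_orbitMap, LinearMap.comp_apply])
    (hE.embedding.toIsUCP.comp d.isUCP)
    (fun g x => by rw [LinearMap.comp_apply, hdG, hE.equivariant, LinearMap.comp_apply])
  have hψ' : ∀ f, ψ (orbitMap G X f) = j f := fun f => LinearMap.congr_fun hψj (f.comp down)
  refine ⟨θ, ψ, hθ, hψ, hE.rigid _ (hψ.comp hθ) (fun g x => ?_) ?_, hθj⟩
  · rw [LinearMap.comp_apply, hθG, hψG, LinearMap.comp_apply]
  · ext f
    rw [LinearMap.comp_apply, LinearMap.comp_apply, hθj, hψ']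

theorem isUCP_symm {V W : Type*} [AddCommGroup V] [Module ℂ V] [StarAddMonoid V] [StarModule ℂ V]
    [OperatorSystem V] [AddCommGroup W] [Module ℂ W] [StarAddMonoid W] [StarModule ℂ W]
    [OperatorSystem W] {e : V ≃ₗ[ℂ] W} (he : IsCompleteOrderEmbedding e.toLinearMap) :
    IsUCP e.symm.toLinearMap where
  map_unit := (e.symm_apply_eq).mpr he.map_unit.symm
  map_mem n M hM := he.reflects n _ (by
    convert hM using 1
    ext i j
    exact e.apply_symm_apply _)

end

theorem theorem4p2
    (G : Type u) [Group G]
    (X : Type v) [TopologicalSpace X] [CompactSpace X] [T2Space X]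
    [MulAction G X] [ContinuousConstSMul G X]
    (E : Type (max u v)) [AddCommGroup E] [Module ℂ E] [StarAddMonoid E] [StarModule ℂ E]
    [OperatorSystem E] [DistribMulAction G E] [SMulCommClass G ℂ E] [IsGOperatorSystem G E]
    (j : C(X, ℂ) →ₗ[ℂ] E) (hE : IsGInjectiveEnvelope G j) :
    ∃ (A : Type (max u v)) (_ : CommCStarAlgebra A) (e : E ≃ₗ[ℂ] A),
      -- `e` identifies the operator system `E` with the abelian C*-algebra `A`
      IsCompleteOrderEmbedding (e : E →ₗ[ℂ] A) ∧
      -- the product of `A` is the Choi–Effros product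
      (∀ (B : Type w) [CStarAlgebra B] (i : E →ₗ[ℂ] B) (φ : B →ₗ[ℂ] E),
        IsCompleteOrderEmbedding i → IsUCP φ → φ ∘ₗ i = LinearMap.id →
          ∀ x y : E, e (φ (i x * i y)) = e x * e y) ∧
      -- `G` acts by algebra automorphisms, and `C(X)` is a subalgebra
      (∀ (g : G) (x y : E), e (g • e.symm (e x * e y)) = e (g • x) * e (g • y)) ∧
      (∀ f h : C(X, ℂ), e (j (f * h)) = e (j f) * e (j h)) := by
  obtain ⟨θ, ψ, hθ, hψ, hψθ, hθj⟩ := hE.exists_retraction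
  have he := isCompleteOrderEmbedding_retractEquiv hθ hψ hψθ
  have hsymm := isUCP_symm he
  refine ⟨_, inferInstance, retractEquiv hθ hψ hψθ, he, ?_, ?_, ?_⟩
  · intro B _ i φ hi hφ hφi x y
    -- Transported along `e`, the pair `(i, φ)` becomes a retraction of `B` onto the C*-algebra `A`.
    have := IsUCP.map_mul_of_leftInverse (hi.toIsUCP.comp hsymm) (he.toIsUCP.comp hφ)
      (LinearMap.ext fun a => by
        have := LinearMap.congr_fun hφi ((retractEquiv hθ hψ hψθ).symm a)
        simp only [LinearMap.comp_apply, LinearMap.id_apply] at this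
        simp [this]) (retractEquiv hθ hψ hψθ x) (retractEquiv hθ hψ hψθ y)
    simpa using this
  · intro g x y
    -- The inclusion is the action of `g⁻¹` and the retraction that of `g`, both transported to `A`.
    have := IsUCP.map_mul_of_leftInverse
      (he.toIsUCP.comp ((isUCP_smul g⁻¹).comp hsymm)) (he.toIsUCP.comp ((isUCP_smul g).comp hsymm))
      (LinearMap.ext fun a => by simp)
      (retractEquiv hθ hψ hψθ (g • x)) (retractEquiv hθ hψ hψθ (g • y))
    simpa using this
  · intro f h
    -- In `ℓ^∞(G × X)` the product of `θ (j f)` and `θ (j h)` is already `θ (j (f * h))`, which `θ ∘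
    -- ψ` fixes.
    refine ChoiEffros.incl_injective ?_
    rw [ChoiEffros.incl_mul, incl_retractEquiv, incl_retractEquiv, incl_retractEquiv, hθj, hθj, hθj,
      ← orbitMap_mul, ← hθj, LinearMap.comp_apply]
    exact congrArg θ (LinearMap.congr_fun hψθ _).symm
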